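/- Let $(Q,g)$ be a compact smooth Riemannian manifold (Hausdorff, without boundary, of dimension $d\ge 0$, not assumed connected), and let $G$ be a finite group that acts on $Q$ freely, properly discontinuously and by isometries, i.e. every element of $G$ acts by a diffeomorphism of $Q$ that preserves $g$. Let $\pi:Q\to Q/G$ be the canonical projection onto the orbit space, and give $Q/G$ the quotient smooth structure, whose charts are local inverses of $\pi$ followed by charts of $Q$, and the quotient metric $$\bar g_{\pi(q)}(v,w)=g_q\big((d\pi_q)^{-1}v,(d\pi_q)^{-1}w\big),$$ for which $\pi$ is a local isometry. Then the total Riemannian volumes satisfy $$\operatorname{Vol}(Q/G)=\frac{\operatorname{Vol}(Q)}{|G|},$$ where the Riemannian volume of a measurable set contained in a chart domain is the integral of $\sqrt{\det(g_{ij})}$ over the image of the set under the chart. -/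

import Mathlib

open MeasureTheory MulAction
open scoped Manifold ContDiff

noncomputable section

/-! ### The volume of a Riemannian manifold -/

section Volume

variable {d : ℕ} {M : Type*} [TopologicalSpace M] [ChartedSpace (EuclideanSpace ℝ (Fin d)) M]

/-- The coordinate vector `∂ᵢ` of the chart `φ` around `x`, at the point `φ⁻¹ z`. -/
def coordVector (x : M) (z : EuclideanSpace ℝ (Fin d)) (i : Fin d) :
    TangentSpace (𝓡 d) ((extChartAt (𝓡 d) x).symm z) :=
  mfderiv (𝓡 d) (𝓡 d) (extChartAt (𝓡 d) x).symm z
    (EuclideanSpace.single i (1 : ℝ) : EuclideanSpace ℝ (Fin d))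

variable (g : Bundle.RiemannianMetric (fun x : M ↦ TangentSpace (𝓡 d) x))

/-- The Gram matrix `gᵢⱼ = g(∂ᵢ, ∂ⱼ)` of the metric in the chart `φ` around `x`, at the point
`φ⁻¹ z`. -/
def chartGram (x : M) (z : EuclideanSpace ℝ (Fin d)) : Matrix (Fin d) (Fin d) ℝ :=
  Matrix.of fun i j ↦
    g.inner ((extChartAt (𝓡 d) x).symm z) (coordVector x z i) (coordVector x z j)

/-- The Riemannian volume of the domain of the chart `φ` around `x`, as a measure on `M` that is
concentrated on this domain: it sends `A` to `∫ √(det gᵢⱼ)` over `φ(A ∩ dom φ)`. -/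
def chartVolume [MeasurableSpace M] (x : M) : Measure M :=
  ((volume.restrict (extChartAt (𝓡 d) x).target).withDensity
    fun z ↦ ENNReal.ofReal √(chartGram g x z).det).map (extChartAt (𝓡 d) x).symm

/-- The Riemannian volume measure. By the change of variables formula the measures `chartVolume g x`
and `chartVolume g y` agree on the intersection of the two chart domains. The measure obtained by
gluing them, whose restriction to the domain of the chart around `x` is `chartVolume g x`, is the
smallest measure above all of them. -/
def riemannianVolume [MeasurableSpace M] : Measure M :=
  ⨆ x : M, chartVolume g x

/-- The total volume `Vol(M) ∈ [0, ∞]` of the Riemannian manifold `(M, g)`. -/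
def Vol : ENNReal :=
  letI : MeasurableSpace M := borel M
  riemannianVolume g Set.univ

end Volume

/-! ### Actions by isometries and the quotient metric

The orbit space `Q/G` of a free, properly discontinuous action carries the quotient topology and
Mathlib's atlas `MulAction.instChartedSpaceQuotient`, whose charts are the local inverses of the
projection `π : Q → Q/G` followed by charts of `Q`. -/

section Quotient

/-- The canonical projection `π : Q → Q/G`. -/
def quotientProj (G : Type*) {Q : Type*} [Group G] [MulAction G Q] (q : Q) :
    orbitRel.Quotient G Q :=
  Quotient.mk (orbitRel G Q) q

theorem quotientProj_smul {G Q : Type*} [Group G] [MulAction G Q] (a : G) (q : Q) :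
    quotientProj G (a • q) = quotientProj G q :=
  Quotient.sound ⟨a, rfl⟩

variable {d : ℕ} {Q : Type*} [TopologicalSpace Q] [ChartedSpace (EuclideanSpace ℝ (Fin d)) Q]
  (G : Type*) [Group G] [MulAction G Q]

/-- The group `G` acts on `(Q, g)` by (Riemannian) isometries: every element acts by a smooth map
that preserves the Riemannian metric. (It is a diffeomorphism, as its inverse also acts
smoothly.) -/
structure IsIsometricAction (g : Bundle.RiemannianMetric (fun x : Q ↦ TangentSpace (𝓡 d) x)) :
    Prop where
  contMDiff (a : G) : ContMDiff (𝓡 d) (𝓡 d) ∞ (fun q : Q ↦ a • q)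
  inner_mfderiv (a : G) (q : Q) (v w : TangentSpace (𝓡 d) q) :
    g.inner (a • q) (mfderiv (𝓡 d) (𝓡 d) (fun q : Q ↦ a • q) q v)
      (mfderiv (𝓡 d) (𝓡 d) (fun q : Q ↦ a • q) q w) = g.inner q v w

variable {G}

theorem IsIsometricAction.mfderiv_smul_comp
    {g : Bundle.RiemannianMetric (fun x : Q ↦ TangentSpace (𝓡 d) x)}
    (hG : IsIsometricAction G g) {a b : G} (hab : b * a = 1) {q q' : Q} (hq : q' = a • q) :
    (mfderiv (𝓡 d) (𝓡 d) (fun q : Q ↦ b • q) q').comp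
      (mfderiv (𝓡 d) (𝓡 d) (fun q : Q ↦ a • q) q) =
      ContinuousLinearMap.id ℝ (EuclideanSpace ℝ (Fin d)) := by
  subst hq
  have h1 := ((hG.contMDiff a).mdifferentiable (by simp) q).hasMFDerivAt
  have h2 := ((hG.contMDiff b).mdifferentiable (by simp) (a • q)).hasMFDerivAt
  have h3 := HasMFDerivAt.comp q h2 h1
  have h4 : (fun q : Q ↦ b • q) ∘ (fun q : Q ↦ a • q) = id := by
    funext x
    simp [smul_smul, hab]
  rw [h4] at h3
  exact hasMFDerivAt_unique h3 (hasMFDerivAt_id q)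

theorem IsIsometricAction.isInvertible_mfderiv_smul
    {g : Bundle.RiemannianMetric (fun x : Q ↦ TangentSpace (𝓡 d) x)}
    (hG : IsIsometricAction G g) (a : G) (q : Q) :
    (mfderiv (𝓡 d) (𝓡 d) (fun q : Q ↦ a • q) q).IsInvertible :=
  ContinuousLinearMap.IsInvertible.of_inverse
    (hG.mfderiv_smul_comp (a := a⁻¹) (b := a) (by simp) (q := a • q) (by simp))
    (hG.mfderiv_smul_comp (a := a) (b := a⁻¹) (by simp) rfl)

variable [ProperlyDiscontinuousSMul G Q] [ContinuousConstSMul G Q] [IsCancelSMul G Q]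
  [T2Space Q] [LocallyCompactSpace Q]

/-- Read in the preferred charts, the projection agrees near `q` with the action of some group
element `a` (the one that moves `q` to the point at which the chart of `Q/G` is based). -/
theorem exists_hasMFDerivAt_quotientProj (q : Q) :
    ∃ a : G, ∀ D : EuclideanSpace ℝ (Fin d) →L[ℝ] EuclideanSpace ℝ (Fin d),
      HasMFDerivAt (𝓡 d) (𝓡 d) (fun q : Q ↦ a • q) q D →
      HasMFDerivAt (𝓡 d) (𝓡 d) (quotientProj G : Q → orbitRel.Quotient G Q) q D := by
  have hf : IsLocalHomeomorph (Quotient.mk (orbitRel G Q)) :=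
    isQuotientCoveringMap_quotientMk_of_properlyDiscontinuousSMul.isCoveringMap.isLocalHomeomorph
  have hs := (Quotient.mk_surjective (s := orbitRel G Q)).hasRightInverse
  obtain ⟨s, hsq, hchart⟩ : ∃ s : Q, Quotient.mk (orbitRel G Q) s = Quotient.mk _ q ∧
      chartAt (EuclideanSpace ℝ (Fin d)) (quotientProj G q) =
        (hf.localInverseAt s).trans (chartAt (EuclideanSpace ℝ (Fin d)) s) :=
    ⟨hs.choose (Quotient.mk _ q), hs.choose_spec _, rfl⟩
  obtain ⟨a, rfl⟩ : ∃ a : G, a • q = s := Quotient.exact hsq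
  have h : ∀ᶠ q' in nhds q, hf.localInverseAt (a • q) (Quotient.mk _ q') = a • q' := by
    have hcont : ContinuousAt (fun q' : Q ↦ a • q') q := (continuous_const_smul a).continuousAt
    filter_upwards [hcont.preimage_mem_nhds
      ((hf.localInverseAt (a • q)).open_target.mem_nhds hf.self_mem_localInverseAt_target)]
      with q' hq'
    have h1 := (hf.localInverseAt (a • q)).right_inv hq'
    rw [hf.localInverseAt_symm] at h1
    rwa [show Quotient.mk (orbitRel G Q) q' = Quotient.mk _ (a • q') from
      (quotientProj_smul a q').symm]
  have h2 : Filter.Tendsto (extChartAt (𝓡 d) q).symm (nhds (extChartAt (𝓡 d) q q)) (nhds q) := by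
    have := (continuousAt_extChartAt_symm (I := 𝓡 d) q).tendsto
    rwa [extChartAt_to_inv] at this
  have h3 : writtenInExtChartAt (𝓡 d) (𝓡 d) q (quotientProj G) =ᶠ[nhds (extChartAt (𝓡 d) q q)]
      writtenInExtChartAt (𝓡 d) (𝓡 d) q (fun q' : Q ↦ a • q') := by
    filter_upwards [h2.eventually h] with z hz
    simp only [writtenInExtChartAt, extChartAt, hchart, Function.comp] at hz ⊢
    simpa [quotientProj] using congrArg (chartAt (EuclideanSpace ℝ (Fin d)) (a • q)) hz
  exact ⟨a, fun D hD ↦ ⟨hf.continuous.continuousAt,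
    hD.2.congr_of_eventuallyEq (h3.filter_mono nhdsWithin_le_nhds) h3.eq_of_nhds⟩⟩

theorem IsIsometricAction.isInvertible_mfderiv_quotientProj
    {g : Bundle.RiemannianMetric (fun x : Q ↦ TangentSpace (𝓡 d) x)}
    (hG : IsIsometricAction G g) (q : Q) :
    MDifferentiableAt (𝓡 d) (𝓡 d) (quotientProj G : Q → orbitRel.Quotient G Q) q ∧
      (mfderiv (𝓡 d) (𝓡 d) (quotientProj G : Q → orbitRel.Quotient G Q) q).IsInvertible := by
  obtain ⟨a, ha⟩ := exists_hasMFDerivAt_quotientProj (d := d) (G := G) q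
  have h1 := ha _ ((hG.contMDiff a).mdifferentiable (by simp) q).hasMFDerivAt
  refine ⟨h1.mdifferentiableAt, ?_⟩
  rw [h1.mfderiv]
  exact hG.isInvertible_mfderiv_smul a q

variable (G) in
/-- The inner product `(v, w) ↦ g_q((dπ_q)⁻¹ v, (dπ_q)⁻¹ w)` on the tangent space of `Q/G` at
`π q`. -/
def pushforwardInner (g : Bundle.RiemannianMetric (fun x : Q ↦ TangentSpace (𝓡 d) x)) (q : Q) :
    TangentSpace (𝓡 d) (quotientProj G q) →L[ℝ] TangentSpace (𝓡 d) (quotientProj G q) →L[ℝ] ℝ :=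
  letI A : EuclideanSpace ℝ (Fin d) →L[ℝ] EuclideanSpace ℝ (Fin d) :=
    (mfderiv (𝓡 d) (𝓡 d) (quotientProj G : Q → orbitRel.Quotient G Q) q).inverse
  letI B : EuclideanSpace ℝ (Fin d) →L[ℝ] EuclideanSpace ℝ (Fin d) →L[ℝ] ℝ := g.inner q
  B.bilinearComp A A

theorem pushforwardInner_apply (g : Bundle.RiemannianMetric (fun x : Q ↦ TangentSpace (𝓡 d) x))
    (q : Q) (v w : TangentSpace (𝓡 d) (quotientProj G q)) :
    pushforwardInner G g q v w =
      g.inner q ((mfderiv (𝓡 d) (𝓡 d) (quotientProj G : Q → orbitRel.Quotient G Q) q).inverse v)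
        ((mfderiv (𝓡 d) (𝓡 d) (quotientProj G : Q → orbitRel.Quotient G Q) q).inverse w) :=
  rfl

/-- The pushed forward inner product does not depend on the representative of the orbit. -/
theorem IsIsometricAction.pushforwardInner_smul
    {g : Bundle.RiemannianMetric (fun x : Q ↦ TangentSpace (𝓡 d) x)}
    (hG : IsIsometricAction G g) (a : G) (q : Q) (v w : EuclideanSpace ℝ (Fin d)) :
    pushforwardInner G g (a • q) v w = pushforwardInner G g q v w := by
  obtain ⟨h1, h2⟩ := hG.isInvertible_mfderiv_quotientProj q
  obtain ⟨h1', h2'⟩ := hG.isInvertible_mfderiv_quotientProj (a • q)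
  have h4 : (quotientProj G : Q → orbitRel.Quotient G Q) ∘ (fun q : Q ↦ a • q) =
      quotientProj G := funext (quotientProj_smul a)
  have h3 := HasMFDerivAt.comp q h1'.hasMFDerivAt
    ((hG.contMDiff a).mdifferentiable (by simp) q).hasMFDerivAt
  rw [h4] at h3
  have h5 := hasMFDerivAt_unique h3 h1.hasMFDerivAt
  have key (v : EuclideanSpace ℝ (Fin d)) :
      (mfderiv (𝓡 d) (𝓡 d) (quotientProj G : Q → orbitRel.Quotient G Q) (a • q)).inverse v =
      mfderiv (𝓡 d) (𝓡 d) (fun q : Q ↦ a • q) q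
        ((mfderiv (𝓡 d) (𝓡 d) (quotientProj G : Q → orbitRel.Quotient G Q) q).inverse v) := by
    refine h2'.inverse_apply_eq.2 ?_
    have := DFunLike.congr_fun h5
      ((mfderiv (𝓡 d) (𝓡 d) (quotientProj G : Q → orbitRel.Quotient G Q) q).inverse v)
    exact ((h2.self_apply_inverse v).symm.trans this.symm)
  refine (congrArg₂ (fun x y ↦ g.inner (a • q) x y) (key v) (key w)).trans ?_
  exact hG.inner_mfderiv a q _ _

/-- The quotient metric on `Q/G`: the inner product at `π q` is
`(v, w) ↦ g_q((dπ_q)⁻¹ v, (dπ_q)⁻¹ w)`, for any representative `q` of the orbit. It is the unique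
metric for which the projection `π` is a local isometry. -/
def quotientMetric (g : Bundle.RiemannianMetric (fun x : Q ↦ TangentSpace (𝓡 d) x))
    (hG : IsIsometricAction G g) :
    Bundle.RiemannianMetric (fun p : orbitRel.Quotient G Q ↦ TangentSpace (𝓡 d) p) where
  inner p := Quotient.lift
    (fun q ↦ (pushforwardInner G g q :
      EuclideanSpace ℝ (Fin d) →L[ℝ] EuclideanSpace ℝ (Fin d) →L[ℝ] ℝ))
    (by
      rintro _ q ⟨a, rfl⟩
      ext v w
      exact hG.pushforwardInner_smul a q v w) p
  symm := by
    rintro ⟨q⟩ v w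
    exact g.symm q _ _
  pos := by
    rintro ⟨q⟩ v hv
    refine g.pos q _ fun h ↦ hv ?_
    exact ((hG.isInvertible_mfderiv_quotientProj q).2.inverse_apply_eq.1 h).trans (map_zero _)
  continuousAt := by
    rintro ⟨q⟩
    have h := ((mfderiv (𝓡 d) (𝓡 d)
      (quotientProj G : Q → orbitRel.Quotient G Q) q).inverse.continuous.tendsto' 0 0
      (map_zero _))
    have h' := (g.continuousAt q).tendsto.comp h
    exact h'.mono_right (congrArg nhds (congrArg (fun x ↦ g.inner q x x) (map_zero _).symm)).le
  isVonNBounded := by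
    rintro ⟨q⟩
    refine ((g.isVonNBounded q).image
      (mfderiv (𝓡 d) (𝓡 d) (quotientProj G : Q → orbitRel.Quotient G Q) q)).subset ?_
    intro v hv
    exact ⟨_, hv, (hG.isInvertible_mfderiv_quotientProj q).2.self_apply_inverse v⟩

/-- The projection `π : Q → Q/G` is a local isometry. -/
theorem quotientMetric_inner_mfderiv
    {g : Bundle.RiemannianMetric (fun x : Q ↦ TangentSpace (𝓡 d) x)}
    (hG : IsIsometricAction G g) (q : Q) (v w : TangentSpace (𝓡 d) q) :
    (quotientMetric g hG).inner (quotientProj G q)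
      (mfderiv (𝓡 d) (𝓡 d) (quotientProj G) q v) (mfderiv (𝓡 d) (𝓡 d) (quotientProj G) q w) =
      g.inner q v w := by
  have h := (hG.isInvertible_mfderiv_quotientProj q).2
  refine (pushforwardInner_apply g q _ _).trans ?_
  rw [h.inverse_apply_self, h.inverse_apply_self]

end Quotient

end

/-! ### Chart volumes and change of variables -/

section Volume

variable {d : ℕ} {M : Type*} [TopologicalSpace M] [ChartedSpace (EuclideanSpace ℝ (Fin d)) M]

/-! The projection π is a |G|-sheeted local isometry, so small sets in Q/G lift to |G| copies of
equal volume. Precisely, |G|⁻¹ π_* vol_Q agrees on every chart domain of Q/G with the volume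
computed in that chart, and a measure with this property is the supremum of the chart volumes
(`iSup_eq_of_restrict_eq`). This gives `riemannianVolume_quotientMetric`, and the theorem is its
value on the whole space. Since the glued measure is known in advance, compatibility of the charts
of Q/G is not needed.

A chart of Q/G is a chart of Q on a sheet V where π is injective, with the same Gram matrix. If S is
the part of π⁻¹(A) in V and in that chart domain of Q, then the preimage of the part of A in the
chart domain of Q/G is the disjoint union of the |G| translates of S, which have equal volume by
`map_riemannianVolume`.

On Q itself the chart volumes must be shown to agree on overlaps, so that their supremum is correct
inside each chart. This and the invariance under isometries both come from the change of variables
in `chartVolume_preimage`, applied to the identity and to an isometry. -/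

theorem measurableSet_extChartAt_target (x : M) : MeasurableSet (extChartAt (𝓡 d) x).target :=
  (isOpen_extChartAt_target x).measurableSet

theorem measurableSet_extChartAt_source [MeasurableSpace M] [BorelSpace M] (x : M) :
    MeasurableSet (extChartAt (𝓡 d) x).source :=
  (isOpen_extChartAt_source x).measurableSet

/-- The part of the image of a chart that corresponds to a Borel set is a Borel set. -/
theorem measurableSet_extChartAt_target_inter_preimage [MeasurableSpace M] [BorelSpace M] (x : M)
    {A : Set M} (hA : MeasurableSet A) :
    MeasurableSet ((extChartAt (𝓡 d) x).target ∩ (extChartAt (𝓡 d) x).symm ⁻¹' A) := by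
  have h := (continuousOn_extChartAt_symm (I := 𝓡 d) x).domRestrict.measurable hA
  have := (measurableSet_extChartAt_target x).subtype_image h
  convert this using 1
  ext z
  simp [and_comm]

theorem chartVolume_apply [MeasurableSpace M] [BorelSpace M]
    (g : Bundle.RiemannianMetric (fun x : M ↦ TangentSpace (𝓡 d) x)) (x : M)
    {A : Set M} (hA : MeasurableSet A) :
    chartVolume g x A = ∫⁻ z in (extChartAt (𝓡 d) x).target ∩ (extChartAt (𝓡 d) x).symm ⁻¹' A,
      ENNReal.ofReal √(chartGram g x z).det := by
  have hm : AEMeasurable (extChartAt (𝓡 d) x).symm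
      (volume.restrict (extChartAt (𝓡 d) x).target) :=
    (continuousOn_extChartAt_symm x).aemeasurable (measurableSet_extChartAt_target x)
  -- The inverse chart is continuous only on the target, so the full preimage of `A` need not be
  -- Borel; `withDensity_apply'` uses s-finiteness instead.
  rw [chartVolume, Measure.map_apply_of_aemeasurable
    (hm.mono_ac (withDensity_absolutelyContinuous _ _)) hA, withDensity_apply',
    Measure.restrict_restrict' (measurableSet_extChartAt_target x), Set.inter_comm]

theorem chartVolume_restrict_source [MeasurableSpace M] [BorelSpace M]
    (g : Bundle.RiemannianMetric (fun x : M ↦ TangentSpace (𝓡 d) x)) (x : M) :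
    (chartVolume g x).restrict (extChartAt (𝓡 d) x).source = chartVolume g x := by
  ext A hA
  rw [Measure.restrict_apply hA, chartVolume_apply g x hA,
    chartVolume_apply g x (hA.inter (measurableSet_extChartAt_source x))]
  congr 2
  ext z
  simp only [Set.mem_inter_iff, Set.mem_preimage]
  exact ⟨fun h ↦ ⟨h.1, h.2.1⟩, fun h ↦ ⟨h.1, h.2, (extChartAt (𝓡 d) x).map_target h.1⟩⟩

/-- Pulling a bilinear form back along `F` turns its matrix S into FᵀSF. -/
theorem det_gram_comp {V : Type*} [AddCommGroup V] [Module ℝ V]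
    (B : V →ₗ[ℝ] V →ₗ[ℝ] ℝ) (C : EuclideanSpace ℝ (Fin d) →ₗ[ℝ] V)
    (F : EuclideanSpace ℝ (Fin d) →L[ℝ] EuclideanSpace ℝ (Fin d)) :
    (Matrix.of fun i j ↦ B (C (F (EuclideanSpace.single i 1)))
      (C (F (EuclideanSpace.single j 1)))).det = F.det ^ 2 *
    (Matrix.of fun i j ↦ B (C (EuclideanSpace.single i 1)) (C (EuclideanSpace.single j 1))).det := by
  let b := (EuclideanSpace.basisFun (Fin d) ℝ).toBasis
  have h1 : ∀ D : EuclideanSpace ℝ (Fin d) →ₗ[ℝ] V,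
      (Matrix.of fun i j ↦ B (D (EuclideanSpace.single i 1)) (D (EuclideanSpace.single j 1))) =
      LinearMap.toMatrix₂ b b (B.compl₁₂ D D) := by
    intro D
    ext i j
    simp [b, LinearMap.toMatrix₂_apply]
  have h2 := LinearMap.toMatrix₂_compl₁₂ b b b b (B.compl₁₂ C C) F.toLinearMap F.toLinearMap
  have h3 := h1 (C ∘ₗ F.toLinearMap)
  simp only [LinearMap.comp_apply] at h3
  refine (congrArg Matrix.det h3).trans ?_
  rw [h1 C]
  have : B.compl₁₂ (C ∘ₗ F.toLinearMap) (C ∘ₗ F.toLinearMap) =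
    (B.compl₁₂ C C).compl₁₂ F.toLinearMap F.toLinearMap := rfl
  rw [this, h2, Matrix.det_mul, Matrix.det_mul, Matrix.det_transpose, LinearMap.det_toMatrix]
  simp only [ContinuousLinearMap.det]
  ring

variable {N : Type*} [TopologicalSpace N] [ChartedSpace (EuclideanSpace ℝ (Fin d)) N]

/-- In charts, the Gram matrices of isometric metrics have determinants that differ by the square of
the Jacobian determinant. -/
theorem exists_hasFDerivAt_det_chartGram [IsManifold (𝓡 d) 1 M] [IsManifold (𝓡 d) 1 N]
    (g : Bundle.RiemannianMetric (fun x : M ↦ TangentSpace (𝓡 d) x))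
    (g' : Bundle.RiemannianMetric (fun x : N ↦ TangentSpace (𝓡 d) x))
    {f : M → N} (hf : MDifferentiable (𝓡 d) (𝓡 d) f)
    (hg : ∀ (q : M) (v w : TangentSpace (𝓡 d) q),
      g'.inner (f q) (mfderiv (𝓡 d) (𝓡 d) f q v) (mfderiv (𝓡 d) (𝓡 d) f q w) = g.inner q v w)
    (x : M) (y : N) {z : EuclideanSpace ℝ (Fin d)} (hz : z ∈ (extChartAt (𝓡 d) x).target)
    (hfz : f ((extChartAt (𝓡 d) x).symm z) ∈ (extChartAt (𝓡 d) y).source) :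
    ∃ F : EuclideanSpace ℝ (Fin d) →L[ℝ] EuclideanSpace ℝ (Fin d),
      HasFDerivAt (fun z ↦ extChartAt (𝓡 d) y (f ((extChartAt (𝓡 d) x).symm z))) F z ∧
      (chartGram g x z).det = F.det ^ 2 *
        (chartGram g' y (extChartAt (𝓡 d) y (f ((extChartAt (𝓡 d) x).symm z)))).det := by
  set φ := (extChartAt (𝓡 d) x).symm with hφ
  set ψ := extChartAt (𝓡 d) y with hψ
  have h1 : MDifferentiableAt (𝓡 d) (𝓡 d) φ z :=
    (mdifferentiableOn_extChartAt_symm z hz).mdifferentiableAt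
      ((isOpen_extChartAt_target x).mem_nhds hz)
  have h2 : MDifferentiableAt (𝓡 d) (𝓡 d) ψ (f (φ z)) :=
    mdifferentiableAt_extChartAt (by simpa [hψ] using hfz)
  have h3 : MDifferentiableAt (𝓡 d) (𝓡 d) ψ.symm (ψ (f (φ z))) :=
    (mdifferentiableOn_extChartAt_symm _ (ψ.map_source hfz)).mdifferentiableAt
      ((isOpen_extChartAt_target y).mem_nhds (ψ.map_source hfz))
  have h4 := HasMFDerivAt.comp z (hf (φ z)).hasMFDerivAt h1.hasMFDerivAt
  have h5 := HasMFDerivAt.comp z h2.hasMFDerivAt h4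
  have h6 := HasMFDerivAt.comp z h3.hasMFDerivAt h5
  have h7 : ψ.symm ∘ ψ ∘ f ∘ φ =ᶠ[nhds z] f ∘ φ := by
    have hc : ContinuousAt (f ∘ φ) z := h4.continuousAt
    filter_upwards [hc.preimage_mem_nhds ((isOpen_extChartAt_source y).mem_nhds hfz)] with w hw
    exact ψ.left_inv hw
  have h8 := hasMFDerivAt_unique (h6.congr_of_eventuallyEq h7.symm) h4
  refine ⟨_, h5.hasFDerivAt, ?_⟩
  -- Since ψ⁻¹ ∘ ψ is the identity near f(φ z), df(∂ᵢ) is the image under dψ⁻¹ of the i-th column of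
  -- the Jacobian F.
  have h9 (i : Fin d) : mfderiv (𝓡 d) (𝓡 d) f (φ z) (coordVector x z i) =
      mfderiv (𝓡 d) (𝓡 d) ψ.symm (ψ (f (φ z)))
        (((mfderiv (𝓡 d) (𝓡 d) ψ (f (φ z))).comp ((mfderiv (𝓡 d) (𝓡 d) f (φ z)).comp
          (mfderiv (𝓡 d) (𝓡 d) φ z)) :
            EuclideanSpace ℝ (Fin d) →L[ℝ] EuclideanSpace ℝ (Fin d))
          (EuclideanSpace.single i 1)) :=
    (DFunLike.congr_fun h8 (EuclideanSpace.single i (1 : ℝ) : EuclideanSpace ℝ (Fin d))).symm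
  -- Regarding the metric as a form on the fixed model space allows the base point to be rewritten
  -- without transporting tangent vectors.
  let B (p : N) : EuclideanSpace ℝ (Fin d) →L[ℝ] EuclideanSpace ℝ (Fin d) →L[ℝ] ℝ := g'.inner p
  let C : EuclideanSpace ℝ (Fin d) →L[ℝ] EuclideanSpace ℝ (Fin d) :=
    mfderiv (𝓡 d) (𝓡 d) ψ.symm (ψ (f (φ z)))
  refine Eq.trans ?_ (det_gram_comp (B (ψ.symm (ψ (f (φ z))))).toLinearMap₁₂ C.toLinearMap _)
  congr 1
  ext i j
  have hB : B (ψ.symm (ψ (f (φ z)))) = B (f (φ z)) := congrArg B (ψ.left_inv hfz)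
  refine (hg (φ z) (coordVector x z i) (coordVector x z j)).symm.trans ?_
  rw [h9 i, h9 j]
  exact (DFunLike.congr_fun (DFunLike.congr_fun hB _) _).symm

/-- Isometries preserve the Riemannian volume of sets inside chart domains. -/
theorem chartVolume_preimage [IsManifold (𝓡 d) 1 M] [IsManifold (𝓡 d) 1 N]
    [MeasurableSpace M] [BorelSpace M] [MeasurableSpace N] [BorelSpace N]
    (g : Bundle.RiemannianMetric (fun x : M ↦ TangentSpace (𝓡 d) x))
    (g' : Bundle.RiemannianMetric (fun x : N ↦ TangentSpace (𝓡 d) x))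
    (f : M ≃ₜ N) (hf : MDifferentiable (𝓡 d) (𝓡 d) f)
    (hg : ∀ (q : M) (v w : TangentSpace (𝓡 d) q),
      g'.inner (f q) (mfderiv (𝓡 d) (𝓡 d) f q v) (mfderiv (𝓡 d) (𝓡 d) f q w) = g.inner q v w)
    (x : M) (y : N) {A : Set N} (hA : MeasurableSet A) (hAx : f ⁻¹' A ⊆ (extChartAt (𝓡 d) x).source)
    (hAy : A ⊆ (extChartAt (𝓡 d) y).source) :
    chartVolume g x (f ⁻¹' A) = chartVolume g' y A := by
  have hA' : MeasurableSet (f ⁻¹' A) := f.continuous.measurable hA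
  rw [chartVolume_apply g x hA', chartVolume_apply g' y hA]
  set T := (extChartAt (𝓡 d) x).target ∩ (extChartAt (𝓡 d) x).symm ⁻¹' (f ⁻¹' A) with hT
  have hTm : MeasurableSet T := measurableSet_extChartAt_target_inter_preimage x hA'
  -- The map f read in the two charts; it carries T bijectively onto the image of A in the chart at
  -- y.
  let h (z : EuclideanSpace ℝ (Fin d)) : EuclideanSpace ℝ (Fin d) :=
    extChartAt (𝓡 d) y (f ((extChartAt (𝓡 d) x).symm z))
  have himage : (extChartAt (𝓡 d) y).target ∩ (extChartAt (𝓡 d) y).symm ⁻¹' A = h '' T := by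
    ext w
    constructor
    · rintro ⟨hw, hwA⟩
      have h1 : f.symm ((extChartAt (𝓡 d) y).symm w) ∈ (extChartAt (𝓡 d) x).source :=
        hAx (by simpa using hwA)
      refine ⟨extChartAt (𝓡 d) x (f.symm ((extChartAt (𝓡 d) y).symm w)),
        ⟨(extChartAt (𝓡 d) x).map_source h1, ?_⟩, ?_⟩
      · rw [Set.mem_preimage, (extChartAt (𝓡 d) x).left_inv h1]
        simpa using hwA
      · simp only [h]
        rw [(extChartAt (𝓡 d) x).left_inv h1, f.apply_symm_apply,
          (extChartAt (𝓡 d) y).right_inv hw]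
    · rintro ⟨z, ⟨-, hzA⟩, rfl⟩
      refine ⟨(extChartAt (𝓡 d) y).map_source (hAy hzA), ?_⟩
      rw [Set.mem_preimage, (extChartAt (𝓡 d) y).left_inv (hAy hzA)]
      exact hzA
  have hinj : Set.InjOn h T := fun z hz w hw hzw ↦
    (extChartAt (𝓡 d) x).symm.injOn hz.1 hw.1
      (f.injective ((extChartAt (𝓡 d) y).injOn (hAy hz.2) (hAy hw.2) hzw))
  have key (z : EuclideanSpace ℝ (Fin d)) (hz : z ∈ T) :=
    exists_hasFDerivAt_det_chartGram g g' hf hg x y hz.1 (hAy hz.2)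
  choose! F hF hdet using key
  rw [himage, lintegral_image_eq_lintegral_abs_det_fderiv_mul volume hTm
    (fun z hz ↦ (hF z hz).hasFDerivWithinAt) hinj]
  refine setLIntegral_congr_fun hTm fun z hz ↦ ?_
  rw [hdet z hz, Real.sqrt_mul (sq_nonneg _), Real.sqrt_sq_eq_abs,
    ENNReal.ofReal_mul (abs_nonneg _)]

end Volume

/-! ### Gluing measures along a countable cover -/

section Gluing

variable {α : Type*} [MeasurableSpace α] {ι : Type*}

/-- The supremum of measures obtained by restricting a measure `ν` to the sets of a cover is `ν`. -/
theorem iSup_eq_of_restrict_eq {κ : Type*} [Countable κ] {μ : ι → Measure α} {ν : Measure α}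
    {U : ι → Set α} (h : ∀ i, ν.restrict (U i) = μ i) (k : κ → ι) (hk : ⋃ n, U (k n) = Set.univ)
    (hU : ∀ i, MeasurableSet (U i)) :
    ⨆ i, μ i = ν := by
  have hle : ⨆ i, μ i ≤ ν := iSup_le fun i ↦ h i ▸ Measure.restrict_le_self
  refine Measure.ext_of_iUnion_eq_univ hk fun n ↦ le_antisymm (Measure.restrict_mono le_rfl hle) ?_
  calc ν.restrict (U (k n)) = (μ (k n)).restrict (U (k n)) := by
        rw [← h, Measure.restrict_restrict (hU _), Set.inter_self]
    _ ≤ _ := Measure.restrict_mono le_rfl (le_iSup μ (k n))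

/-- The supremum of measures that are concentrated on the sets of a cover, and agree on overlaps,
restricts to each of them. -/
theorem iSup_restrict_eq {μ : ι → Measure α} {U : ι → Set α} (k : ℕ → ι)
    (hk : ⋃ n, U (k n) = Set.univ) (hU : ∀ i, MeasurableSet (U i))
    (hμ : ∀ i, (μ i).restrict (U i) = μ i)
    (h : ∀ i j A, MeasurableSet A → A ⊆ U i → A ⊆ U j → μ i A = μ j A) (i : ι) :
    (⨆ j, μ j).restrict (U i) = μ i := by
  -- The glued measure: cut the cover into disjoint pieces and use the n-th measure on the n-th
  -- piece.
  let ν : Measure α := Measure.sum fun n ↦ (μ (k n)).restrict (disjointed (fun n ↦ U (k n)) n)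
  have hD (n : ℕ) : MeasurableSet (disjointed (fun n ↦ U (k n)) n) :=
    MeasurableSet.disjointed (fun n ↦ hU (k n)) n
  have hν (i : ι) : ν.restrict (U i) = μ i := by
    ext A hA
    rw [Measure.restrict_apply hA, Measure.sum_apply _ (hA.inter (hU i))]
    have h1 (n : ℕ) : (μ (k n)).restrict (disjointed (fun n ↦ U (k n)) n) (A ∩ U i) =
        μ i (A ∩ U i ∩ disjointed (fun n ↦ U (k n)) n) := by
      rw [Measure.restrict_apply (hA.inter (hU i))]
      exact h _ _ _ ((hA.inter (hU i)).inter (hD n))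
        (Set.inter_subset_right.trans (disjointed_subset _ n))
        (Set.inter_subset_left.trans Set.inter_subset_right)
    simp_rw [h1]
    rw [← measure_iUnion, ← Set.inter_iUnion, iUnion_disjointed, hk, Set.inter_univ,
      ← Measure.restrict_apply hA, hμ]
    · exact fun m n hmn ↦ ((disjoint_disjointed (fun n ↦ U (k n)) hmn).mono
        Set.inter_subset_right Set.inter_subset_right)
    · exact fun n ↦ (hA.inter (hU i)).inter (hD n)
  rw [iSup_eq_of_restrict_eq hν k hk hU, hν]

end Gluing

/-! ### The volume measure of a compact manifold and its invariance -/

section RiemannianVolume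

variable {d : ℕ} {M : Type*} [TopologicalSpace M] [ChartedSpace (EuclideanSpace ℝ (Fin d)) M]

theorem exists_nat_cover_of_mem_nhds {X : Type*} [TopologicalSpace X] [LindelofSpace X] [Nonempty X]
    {U : X → Set X} (hU : ∀ x, U x ∈ nhds x) : ∃ k : ℕ → X, ⋃ n, U (k n) = Set.univ := by
  obtain ⟨s, hs, hsU⟩ := countable_cover_nhds hU
  have hne : s.Nonempty := by
    by_contra h
    rw [Set.not_nonempty_iff_eq_empty] at h
    simp [h, Set.empty_ne_univ] at hsU
  obtain ⟨k, rfl⟩ := hs.exists_eq_range hne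
  exact ⟨k, by simpa using hsU⟩

/-- The Riemannian volume measure restricts to the volume measure of every chart. -/
theorem riemannianVolume_restrict_source [IsManifold (𝓡 d) 1 M] [CompactSpace M]
    [MeasurableSpace M] [BorelSpace M]
    (g : Bundle.RiemannianMetric (fun x : M ↦ TangentSpace (𝓡 d) x)) (x : M) :
    (riemannianVolume g).restrict (extChartAt (𝓡 d) x).source = chartVolume g x := by
  have : Nonempty M := ⟨x⟩
  obtain ⟨k, hk⟩ := exists_nat_cover_of_mem_nhds fun x : M ↦ extChartAt_source_mem_nhds (I := 𝓡 d) x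
  refine iSup_restrict_eq k hk measurableSet_extChartAt_source (chartVolume_restrict_source g)
    (fun x y A hA hAx hAy ↦ ?_) x
  refine chartVolume_preimage g g (Homeomorph.refl M) mdifferentiable_id (fun q v w ↦ ?_) x y hA
    hAx hAy
  have h : mfderiv (𝓡 d) (𝓡 d) (Homeomorph.refl M) q =
      ContinuousLinearMap.id ℝ (TangentSpace (𝓡 d) q) := mfderiv_id
  rw [h]
  rfl

theorem riemannianVolume_apply [IsManifold (𝓡 d) 1 M] [CompactSpace M]
    [MeasurableSpace M] [BorelSpace M]
    (g : Bundle.RiemannianMetric (fun x : M ↦ TangentSpace (𝓡 d) x)) (x : M) {A : Set M}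
    (hA : A ⊆ (extChartAt (𝓡 d) x).source) :
    riemannianVolume g A = chartVolume g x A := by
  rw [← riemannianVolume_restrict_source, Measure.restrict_eq_self _ hA]

variable {N : Type*} [TopologicalSpace N] [ChartedSpace (EuclideanSpace ℝ (Fin d)) N]

/-- Isometries preserve the Riemannian volume measure. -/
theorem map_riemannianVolume [IsManifold (𝓡 d) 1 M] [IsManifold (𝓡 d) 1 N]
    [CompactSpace M] [CompactSpace N]
    [MeasurableSpace M] [BorelSpace M] [MeasurableSpace N] [BorelSpace N]
    (g : Bundle.RiemannianMetric (fun x : M ↦ TangentSpace (𝓡 d) x))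
    (g' : Bundle.RiemannianMetric (fun x : N ↦ TangentSpace (𝓡 d) x))
    (f : M ≃ₜ N) (hf : MDifferentiable (𝓡 d) (𝓡 d) f)
    (hg : ∀ (q : M) (v w : TangentSpace (𝓡 d) q),
      g'.inner (f q) (mfderiv (𝓡 d) (𝓡 d) f q v) (mfderiv (𝓡 d) (𝓡 d) f q w) = g.inner q v w) :
    (riemannianVolume g).map f = riemannianVolume g' := by
  cases isEmpty_or_nonempty N
  · exact Subsingleton.elim _ _
  -- Small enough that both W and its preimage under f lie in single chart domains.
  let W (y : N) : Set N :=
    f.symm ⁻¹' (extChartAt (𝓡 d) (f.symm y)).source ∩ (extChartAt (𝓡 d) y).source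
  have hWo (y : N) : IsOpen (W y) :=
    ((isOpen_extChartAt_source _).preimage f.symm.continuous).inter (isOpen_extChartAt_source _)
  obtain ⟨k, hk⟩ := exists_nat_cover_of_mem_nhds (U := W) fun y ↦ (hWo y).mem_nhds
    ⟨mem_extChartAt_source _, mem_extChartAt_source _⟩
  refine Measure.ext_of_iUnion_eq_univ hk fun n ↦ ?_
  ext A hA
  have hm : MeasurableSet (A ∩ W (k n)) := hA.inter (hWo _).measurableSet
  have h1 : f ⁻¹' (A ∩ W (k n)) ⊆ (extChartAt (𝓡 d) (f.symm (k n))).source :=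
    fun q hq ↦ by simpa using hq.2.1
  have h2 : A ∩ W (k n) ⊆ (extChartAt (𝓡 d) (k n)).source := fun q hq ↦ hq.2.2
  rw [Measure.restrict_apply hA, Measure.restrict_apply hA,
    Measure.map_apply f.continuous.measurable hm, riemannianVolume_apply g _ h1,
    riemannianVolume_apply g' _ h2, chartVolume_preimage g g' f hf hg _ _ hm h1 h2]

end RiemannianVolume

/-! ### The volume of the orbit space -/

section Quotient

variable {d : ℕ} {Q : Type*} [TopologicalSpace Q] [ChartedSpace (EuclideanSpace ℝ (Fin d)) Q]
  {G : Type*} [Group G] [MulAction G Q]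

theorem continuous_quotientProj : Continuous (quotientProj G : Q → orbitRel.Quotient G Q) :=
  continuous_quotient_mk'

variable [ProperlyDiscontinuousSMul G Q] [ContinuousConstSMul G Q] [IsCancelSMul G Q]
  [T2Space Q] [LocallyCompactSpace Q]

/-- The preferred charts of `Q/G` are the preferred charts of `Q`, restricted to open sets on which
the projection is injective. -/
theorem exists_extChartAt_orbitQuotient (p : orbitRel.Quotient G Q) :
    ∃ (s : Q) (V : Set Q), IsOpen V ∧ V.InjOn (quotientProj G) ∧
      ((extChartAt (𝓡 d) p).symm : EuclideanSpace ℝ (Fin d) → orbitRel.Quotient G Q) =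
        quotientProj G ∘ (extChartAt (𝓡 d) s).symm ∧
      (extChartAt (𝓡 d) p).target =
        (extChartAt (𝓡 d) s).target ∩ (extChartAt (𝓡 d) s).symm ⁻¹' V ∧
      (extChartAt (𝓡 d) p).source = quotientProj G '' (V ∩ (extChartAt (𝓡 d) s).source) := by
  have hf : IsLocalHomeomorph (Quotient.mk (orbitRel G Q)) :=
    isQuotientCoveringMap_quotientMk_of_properlyDiscontinuousSMul.isCoveringMap.isLocalHomeomorph
  -- By construction of the atlas; the sheet V is the target of the local inverse of π at `s`.
  obtain ⟨s, hchart⟩ : ∃ s : Q, chartAt (EuclideanSpace ℝ (Fin d)) p =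
      (hf.localInverseAt s).trans (chartAt (EuclideanSpace ℝ (Fin d)) s) := ⟨_, rfl⟩
  have hsymm : ((hf.localInverseAt s).symm : Q → orbitRel.Quotient G Q) = quotientProj G :=
    hf.localInverseAt_symm s
  refine ⟨s, (hf.localInverseAt s).target, (hf.localInverseAt s).open_target,
    hf.injOn_localInverseAt_target, ?_, ?_, ?_⟩
  · ext z
    simp [extChartAt, hchart, ← hsymm]
  · ext z
    simp [extChartAt, hchart]
  · simp only [extChartAt_source, hchart, OpenPartialHomeomorph.trans_source]
    rw [← hsymm, OpenPartialHomeomorph.symm_image_eq_source_inter_preimage _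
      Set.inter_subset_left]
    ext q
    simp +contextual

/-- In the preferred charts of `Q/G`, the Gram matrix of the quotient metric is the Gram matrix of
the metric of `Q`. -/
theorem chartGram_quotientMetric [IsManifold (𝓡 d) 1 Q]
    {g : Bundle.RiemannianMetric (fun x : Q ↦ TangentSpace (𝓡 d) x)}
    (hG : IsIsometricAction G g) {p : orbitRel.Quotient G Q} {s : Q}
    (h : ((extChartAt (𝓡 d) p).symm : EuclideanSpace ℝ (Fin d) → orbitRel.Quotient G Q) =
        quotientProj G ∘ (extChartAt (𝓡 d) s).symm)
    {z : EuclideanSpace ℝ (Fin d)} (hz : z ∈ (extChartAt (𝓡 d) s).target) :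
    chartGram (quotientMetric g hG) p z = chartGram g s z := by
  have h1 : MDifferentiableAt (𝓡 d) (𝓡 d) (extChartAt (𝓡 d) s).symm z :=
    (mdifferentiableOn_extChartAt_symm z hz).mdifferentiableAt
      ((isOpen_extChartAt_target s).mem_nhds hz)
  have h2 := (hG.isInvertible_mfderiv_quotientProj ((extChartAt (𝓡 d) s).symm z)).1
  have h3 := HasMFDerivAt.comp z h2.hasMFDerivAt h1.hasMFDerivAt
  -- As π ∘ φₛ⁻¹ = φₚ⁻¹, the chain rule shows that dπ sends coordinate vectors to coordinate
  -- vectors.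
  rw [← h] at h3
  have h4 (i : Fin d) : coordVector p z i =
      mfderiv (𝓡 d) (𝓡 d) (quotientProj G : Q → orbitRel.Quotient G Q)
        ((extChartAt (𝓡 d) s).symm z) (coordVector s z i) :=
    DFunLike.congr_fun h3.mfderiv (EuclideanSpace.single i (1 : ℝ) : EuclideanSpace ℝ (Fin d))
  let B (p : orbitRel.Quotient G Q) :
    EuclideanSpace ℝ (Fin d) →L[ℝ] EuclideanSpace ℝ (Fin d) →L[ℝ] ℝ := (quotientMetric g hG).inner p
  ext i j
  refine Eq.trans ?_ (quotientMetric_inner_mfderiv hG ((extChartAt (𝓡 d) s).symm z)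
    (coordVector s z i) (coordVector s z j))
  have hB : B ((extChartAt (𝓡 d) p).symm z) = B (quotientProj G ((extChartAt (𝓡 d) s).symm z)) :=
    congrArg B (congrFun h z)
  refine Eq.trans ?_ (DFunLike.congr_fun (DFunLike.congr_fun hB _) _)
  exact congrArg₂ (fun v w ↦ B ((extChartAt (𝓡 d) p).symm z) v w) (h4 i) (h4 j)

/-- Up to a factor, the Riemannian volume of `Q/G` is the pushforward of that of `Q`. -/
theorem riemannianVolume_quotientMetric [IsManifold (𝓡 d) 1 Q] [CompactSpace Q] [Finite G]
    [MeasurableSpace Q] [BorelSpace Q]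
    [MeasurableSpace (orbitRel.Quotient G Q)] [BorelSpace (orbitRel.Quotient G Q)]
    {g : Bundle.RiemannianMetric (fun x : Q ↦ TangentSpace (𝓡 d) x)}
    (hG : IsIsometricAction G g) :
    riemannianVolume (quotientMetric g hG) =
      (Nat.card G : ENNReal)⁻¹ • (riemannianVolume g).map (quotientProj G) := by
  cases isEmpty_or_nonempty Q
  · have : IsEmpty (orbitRel.Quotient G Q) := ⟨fun p ↦ Quotient.inductionOn p isEmptyElim⟩
    exact Subsingleton.elim _ _
  have : Nonempty (orbitRel.Quotient G Q) := ⟨quotientProj G (Classical.arbitrary Q)⟩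
  have : CompactSpace (orbitRel.Quotient G Q) := Quotient.compactSpace
  obtain ⟨k, hk⟩ := exists_nat_cover_of_mem_nhds
    fun p : orbitRel.Quotient G Q ↦ extChartAt_source_mem_nhds (I := 𝓡 d) p
  refine iSup_eq_of_restrict_eq (fun p ↦ ?_) k hk measurableSet_extChartAt_source
  obtain ⟨s, V, hV, hinj, hsymm, htarget, hsource⟩ := exists_extChartAt_orbitQuotient (d := d) p
  have hπ : Measurable (quotientProj G : Q → orbitRel.Quotient G Q) :=
    continuous_quotientProj.measurable
  ext A hA
  have hAm : MeasurableSet (A ∩ (extChartAt (𝓡 d) p).source) :=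
    hA.inter (measurableSet_extChartAt_source p)
  -- The lift of the part of `A` in the chart domain to the single sheet V.
  let S : Set Q := quotientProj G ⁻¹' A ∩ V ∩ (extChartAt (𝓡 d) s).source
  have hSm : MeasurableSet S :=
    ((hπ hA).inter hV.measurableSet).inter (measurableSet_extChartAt_source s)
  have h1 : chartVolume (quotientMetric g hG) p A = chartVolume g s S := by
    rw [chartVolume_apply _ _ hA, chartVolume_apply _ _ hSm]
    have : (extChartAt (𝓡 d) p).target ∩ (extChartAt (𝓡 d) p).symm ⁻¹' A =
        (extChartAt (𝓡 d) s).target ∩ (extChartAt (𝓡 d) s).symm ⁻¹' S := by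
      rw [hsymm, htarget]
      ext z
      exact ⟨fun h ↦ ⟨h.1.1, ⟨h.2, h.1.2⟩, (extChartAt (𝓡 d) s).map_target h.1.1⟩,
        fun h ↦ ⟨⟨h.1, h.2.1.2⟩, h.2.1.1⟩⟩
    rw [this]
    refine setLIntegral_congr_fun (measurableSet_extChartAt_target_inter_preimage s hSm)
      fun z hz ↦ ?_
    simp only [chartGram_quotientMetric hG hsymm hz.1]
  have h2 : quotientProj G ⁻¹' (A ∩ (extChartAt (𝓡 d) p).source) =
      ⋃ a : G, (fun q : Q ↦ a • q) ⁻¹' S := by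
    ext q
    simp only [Set.mem_preimage, Set.mem_iUnion, hsource, S, Set.mem_inter_iff, Set.mem_image,
      quotientProj_smul]
    constructor
    · rintro ⟨hq, r, hr, hrq⟩
      obtain ⟨a, rfl⟩ : ∃ a : G, a • q = r := Quotient.exact hrq
      exact ⟨a, ⟨hq, hr.1⟩, hr.2⟩
    · rintro ⟨a, ⟨hq, ha⟩, ha'⟩
      exact ⟨hq, a • q, ⟨ha, ha'⟩, quotientProj_smul a q⟩
  have h3 (a : G) : riemannianVolume g ((fun q : Q ↦ a • q) ⁻¹' S) = riemannianVolume g S := by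
    conv_rhs => rw [← map_riemannianVolume g g (Homeomorph.smul a)
      ((hG.contMDiff a).mdifferentiable (by simp)) (hG.inner_mfderiv a)]
    exact (Measure.map_apply (Homeomorph.smul a).continuous.measurable hSm).symm
  have h4 : Pairwise (Function.onFun Disjoint fun a : G ↦ (fun q : Q ↦ a • q) ⁻¹' S) := by
    -- If a • q and b • q both lie in V, injectivity of π on V makes them equal, and freeness gives
    -- a = b.
    intro a b hab
    refine Set.disjoint_left.2 fun q hqa hqb ↦ hab ?_
    have : a • q = b • q := hinj hqa.1.2 hqb.1.2 (by simp only [quotientProj_smul])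
    exact IsCancelSMul.right_cancel _ _ _ this
  have h5 : riemannianVolume g (quotientProj G ⁻¹' (A ∩ (extChartAt (𝓡 d) p).source)) =
      Nat.card G * riemannianVolume g S := by
    have := Fintype.ofFinite G
    rw [h2, measure_iUnion h4 fun a ↦ (Homeomorph.smul a).continuous.measurable hSm]
    simp_rw [h3]
    rw [tsum_fintype, Finset.sum_const, Finset.card_univ, nsmul_eq_mul, Nat.card_eq_fintype_card]
  rw [Measure.restrict_apply hA, Measure.smul_apply, Measure.map_apply hπ hAm, h5, h1, smul_eq_mul,
    ← mul_assoc, ENNReal.inv_mul_cancel (by simp [Nat.card_pos.ne']) (by simp), one_mul,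
    riemannianVolume_apply g s Set.inter_subset_right]

end Quotient

theorem lemma1 {d : ℕ}
    {Q : Type*} [TopologicalSpace Q] [T2Space Q] [CompactSpace Q]
    [ChartedSpace (EuclideanSpace ℝ (Fin d)) Q] [IsManifold (𝓡 d) ∞ Q]
    (g : Bundle.ContMDiffRiemannianMetric (𝓡 d) ∞ (EuclideanSpace ℝ (Fin d))
      (fun x : Q ↦ TangentSpace (𝓡 d) x))
    {G : Type*} [Group G] [Finite G] [MulAction G Q]
    [IsCancelSMul G Q] [ContinuousConstSMul G Q] [ProperlyDiscontinuousSMul G Q]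
    (hG : IsIsometricAction G g.toRiemannianMetric) :
    Vol (quotientMetric g.toRiemannianMetric hG) =
      Vol g.toRiemannianMetric / (Nat.card G : ENNReal) := by
  let : MeasurableSpace Q := borel Q
  have : BorelSpace Q := ⟨rfl⟩
  let : MeasurableSpace (orbitRel.Quotient G Q) := borel _
  have : BorelSpace (orbitRel.Quotient G Q) := ⟨rfl⟩
  have : IsManifold (𝓡 d) 1 Q := IsManifold.of_le (n := ∞) (by simp)
  have h := congrArg (· Set.univ) (riemannianVolume_quotientMetric hG)
  refine h.trans ?_
  simp only [Measure.smul_apply, smul_eq_mul]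
  rw [Measure.map_apply continuous_quotientProj.measurable MeasurableSet.univ, Set.preimage_univ,
    mul_comm, ← div_eq_mul_inv]
  rfl
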